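/- **Model.** Two teams, Team $i\in\{1,2\}$ having players $j=1,\dots,N_i$, interact over times $t=1,\dots,T$. All sets below are finite. The state, observations and actions satisfy $$X_{t+1}=f_t(X_t,U_t,W^s_t),\qquad Y^{i,j}_1=h^{i,j}_1(X_1,W^{i,j}_1),\qquad Y^{i,j}_{t+1}=h^{i,j}_{t+1}(X_{t+1},U_t,W^{i,j}_{t+1}),$$ where $U_t=(U^{i,j}_t)_{i,j}$, the action sets $\mathcal U^{i,j}_t$ are nonempty, and $X_1,W^s_t,W^{i,j}_t$ are mutually independent with finitely many values. All players know the common information $C_t=(Z_1,\dots,Z_t)$, and Player $j$ of Team $i$ also has private information $P^{i,j}_t$; with $P_t=(P_t^{i,j})_{i,j}$ and $Y_t=(Y_t^{i,j})_{i,j}$, the variables $Z_1,P_1$ are fixed functions of $Y_1$, and $Z_{t+1}=\zeta_{t+1}(P_t,U_t,Y_{t+1})$, $P_{t+1}=\xi_{t+1}(P_t,U_t,Y_{t+1})$ for fixed functions $\zeta_{t+1},\xi_{t+1}$. A strategy $g^i$ of Team $i$ consists of maps $g^{i,j}_t$ from $(C_t,P^{i,j}_t)$ to distributions on $\mathcal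 U^{i,j}_t$; given the past, all players draw their actions independently from these distributions. The cost is $J(g^1,g^2)=\mathbb E^{(g^1,g^2)}\big[\sum_{t=1}^T c_t(X_t,U_t)\big]$; Team 1 minimizes it and Team 2 maximizes it. The upper value is $S^u=\min_{g^1}\max_{g^2}J(g^1,g^2)$, and $g^1$ is a *min-max strategy* if $\max_{g^2}J(g^1,g^2)=S^u$. **Expanded game and belief.** A prescription of virtual player $i$ at time $t$ is a tuple $\gamma^i_t=(\gamma^{i,j}_t)_j$ of maps from values of $P^{i,j}_t$ to distributions on $\mathcal U^{i,j}_t$; the set of these is $\mathcal B^i_t$. In the expanded game virtual player $i$ chooses $\Gamma^i_t=\tilde\chi^i_t(C_t,\Gamma^{1:2}_{1:t-1})$, and each $U^{i,j}_t$ is drawn independently from $\Gamma^{i,j}_t(P^{i,j}_t)$. The common information belief is the conditional law $$\Pi_t=\mathbb P\big[(X_t,P_t)\in\cdot\,\big|\,C_t,\Gamma^{1:2}_{1:t-1}\big].$$ Let $\mathcal S_t$ be the set of distributions of $(X_t,P_t)$, and $\mathcal Z_t$ the set of values of $Z_t$. **Assumption.** There are maps $F_t:\mathcal S_t\times\mathcal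 B^1_t\times\mathcal Z_{t+1}\to\mathcal S_{t+1}$, $1\le t<T$, such that for every strategy profile $(\tilde\chi^1,\tilde\chi^2)$ of the expanded game, almost surely $\Pi_{t+1}=F_t(\Pi_t,\Gamma^1_t,Z_{t+1})$ for all $1\le t<T$. Call such a family an *update rule*. **Dynamic program.** For an update rule $F$ put $V_{T+1}=0$ and, for $t=T,\dots,1$, $$w_t(\pi,\gamma^1,\gamma^2)=\mathbb E\big[c_t(X_t,U_t)+V_{t+1}(F_t(\pi,\gamma^1,Z_{t+1}))\,\big|\,\pi,\gamma^1,\gamma^2\big],\qquad V_t(\pi)=\inf_{\gamma^1}\sup_{\gamma^2}w_t(\pi,\gamma^1,\gamma^2),$$ where the expectation is taken with $(X_t,P_t)\sim\pi$ and actions drawn by $\gamma^1,\gamma^2$ (at $t=T$ the second term is $0$). A *minimizer* of the dynamic program is a family of maps $\Xi_t:\mathcal S_t\to\mathcal B^1_t$ with $V_t(\pi)=\max_{\gamma^2}w_t(\pi,\Xi_t(\pi),\gamma^2)$ for all $t\le T$ and all $\pi\in\mathcal S_t$. **Algorithm.** Given $F$ and $\Xi$, each player of Team 1 computes $\pi_1=\mathbb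 P[(X_1,P_1)\in\cdot\mid C_1]$ and $\pi_{t+1}=F_t(\pi_t,\Xi_t(\pi_t),Z_{t+1})$, and Player $j$ uses the distribution $g^{1,j*}_t(C_t,P^{1,j}_t)=\Xi^j_t(\pi_t)(P^{1,j}_t)$, where $\Xi^j_t(\pi_t)$ is the $j$-th component of the prescription $\Xi_t(\pi_t)$. **Theorem.** Under the Assumption, there is an update rule $F$ whose dynamic program has a minimizer $\Xi$. Moreover, for every update rule $F$ and every minimizer $\Xi$ of its dynamic program, the strategy $g^{1*}$ given by the Algorithm is a min-max strategy for Team 1 in the original game. -/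

import Mathlib

open scoped BigOperators

universe u

noncomputable section

/-- The probability distribution proportional to the weight `w` on a nonempty finite set.
If `w` is not a nonzero nonnegative weight, the uniform distribution is returned. -/
def normalizeWeight {A : Type u} [Fintype A] [Nonempty A] (w : A → ℝ) : stdSimplex ℝ A :=
  open Classical in
  if h : (∀ a, 0 ≤ w a) ∧ 0 < ∑ a, w a then
    ⟨fun a => w a / ∑ b, w b,
      fun a => div_nonneg (h.1 a) h.2.le, by
        rw [← Finset.sum_div]; exact div_self h.2.ne'⟩
  else stdSimplex.barycenter

/-- The zero-sum game between two teams. Team 1 is index `0`, Team 2 is index `1`, and Team `i`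
has `N i` players. Times `1, …, T` are indexed by `0, …, T - 1` (the data at later times
are irrelevant). All sets are finite; `ΔA` is `stdSimplex ℝ A`.

The common information at a time consists of the increments `Z` received so far; the
increments and the private informations evolve by the fixed transformations `ζ` and `ξ`. -/
structure TeamGame where
  /-- horizon -/
  T : ℕ
  /-- number of players in each team -/
  N : Fin 2 → ℕ
  /-- states -/
  X : ℕ → Type u
  /-- actions -/
  U : ℕ → (i : Fin 2) → Fin (N i) → Type u
  /-- observations -/
  Y : ℕ → (i : Fin 2) → Fin (N i) → Type u
  /-- private informations -/
  P : ℕ → (i : Fin 2) → Fin (N i) → Type u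
  /-- increments of the common information -/
  Z : ℕ → Type u
  /-- values of the system noise -/
  WS : ℕ → Type u
  /-- values of the observation noises -/
  WO : ℕ → (i : Fin 2) → Fin (N i) → Type u
  [fintypeX : ∀ t, Fintype (X t)]
  [fintypeU : ∀ t i j, Fintype (U t i j)]
  [fintypeY : ∀ t i j, Fintype (Y t i j)]
  [fintypeP : ∀ t i j, Fintype (P t i j)]
  [fintypeZ : ∀ t, Fintype (Z t)]
  [fintypeWS : ∀ t, Fintype (WS t)]
  [fintypeWO : ∀ t i j, Fintype (WO t i j)]
  [nonemptyX : ∀ t, Nonempty (X t)]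
  [nonemptyU : ∀ t i j, Nonempty (U t i j)]
  [nonemptyP : ∀ t i j, Nonempty (P t i j)]
  /-- distribution of the initial state -/
  μ : stdSimplex ℝ (X 0)
  /-- distribution of the system noise -/
  νS : ∀ t, stdSimplex ℝ (WS t)
  /-- distributions of the observation noises -/
  νO : ∀ t i j, stdSimplex ℝ (WO t i j)
  /-- state evolution -/
  f : ∀ t, X t → (∀ i j, U t i j) → WS t → X (t + 1)
  /-- observation at the first time (there is no earlier action) -/
  h₀ : ∀ i j, X 0 → WO 0 i j → Y 0 i j
  /-- observation at later times -/
  h : ∀ t i j, X (t + 1) → (∀ i j, U t i j) → WO (t + 1) i j → Y (t + 1) i j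
  /-- common information at the first time -/
  ζ₀ : (∀ i j, Y 0 i j) → Z 0
  /-- increment of common information at later times -/
  ζ : ∀ t, (∀ i j, P t i j) → (∀ i j, U t i j) → (∀ i j, Y (t + 1) i j) → Z (t + 1)
  /-- private information at the first time -/
  ξ₀ : (∀ i j, Y 0 i j) → (∀ i j, P 0 i j)
  /-- private information at later times -/
  ξ : ∀ t, (∀ i j, P t i j) → (∀ i j, U t i j) → (∀ i j, Y (t + 1) i j) →
    (∀ i j, P (t + 1) i j)
  /-- instantaneous cost -/
  c : ∀ t, X t → (∀ i j, U t i j) → ℝ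

namespace TeamGame

attribute [instance] fintypeX fintypeU fintypeY fintypeP fintypeZ fintypeWS fintypeWO
  nonemptyX nonemptyU nonemptyP

variable (M : TeamGame.{u})

/-- Actions of all players at time `t`. -/
abbrev Act (t : ℕ) : Type u := ∀ i j, M.U t i j

/-- Observations of all players at time `t`. -/
abbrev Obs (t : ℕ) : Type u := ∀ i j, M.Y t i j

/-- Private informations of all players at time `t`. -/
abbrev Priv (t : ℕ) : Type u := ∀ i j, M.P t i j

/-- Realizations of the common information at time `t`: the increments received so far. -/
def Common : ℕ → Type u
  | 0 => M.Z 0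
  | t + 1 => Common t × M.Z (t + 1)

/-- Trajectories up to time `t`, before the actions of time `t` are taken. -/
def Play : ℕ → Type u
  | 0 => M.X 0 × M.Obs 0
  | t + 1 => Play t × M.Act t × M.X (t + 1) × M.Obs (t + 1)

/-- There are finitely many trajectories. -/
instance fintypePlay : ∀ t, Fintype (M.Play t)
  | 0 => inferInstanceAs (Fintype (M.X 0 × M.Obs 0))
  | t + 1 =>
    letI := fintypePlay t
    inferInstanceAs (Fintype (M.Play t × M.Act t × M.X (t + 1) × M.Obs (t + 1)))

/-- The current state. -/
def state : ∀ t, M.Play t → M.X t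
  | 0, ω => ω.1
  | _ + 1, ω => ω.2.2.1

/-- The current private informations. -/
def priv : ∀ t, M.Play t → M.Priv t
  | 0, ω => M.ξ₀ ω.2
  | t + 1, ω => M.ξ t (priv t ω.1) ω.2.1 ω.2.2.2

/-- The current increment of the common information. -/
def incr : ∀ t, M.Play t → M.Z t
  | 0, ω => M.ζ₀ ω.2
  | t + 1, ω => M.ζ t (M.priv t ω.1) ω.2.1 ω.2.2.2

/-- The current common information. -/
def common : ∀ t, M.Play t → M.Common t
  | 0, ω => M.incr 0 ω
  | t + 1, ω => (common t ω.1, M.incr (t + 1) ω)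

/-- The sum of the costs of all times before `t`. -/
def totalCost : ∀ t, M.Play t → ℝ
  | 0, _ => 0
  | t + 1, ω => totalCost t ω.1 + M.c t (M.state t ω.1) ω.2.1

/-- Joint probability of the initial state and the initial observations. -/
def initProb (x : M.X 0) (y : M.Obs 0) : ℝ :=
  open Classical in
  M.μ x * ∏ i, ∏ j, ∑ w, if M.h₀ i j x w = y i j then M.νO 0 i j w else 0

/-- Probability of the next state and the next observations, given the current state and the
current actions. -/
def stepProb (t : ℕ) (x : M.X t) (a : M.Act t) (x' : M.X (t + 1)) (y' : M.Obs (t + 1)) : ℝ :=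
  open Classical in
  (∑ w, if M.f t x a w = x' then M.νS t w else 0) *
    ∏ i, ∏ j, ∑ w, if M.h t i j x' a w = y' i j then M.νO (t + 1) i j w else 0

/-- Rules that give, at each time and for each trajectory so far, the distribution from which
each player draws its action. -/
abbrev DrawRule : Type u := ∀ t, M.Play t → ∀ i j, stdSimplex ℝ (M.U t i j)

/-- Probability of a trajectory when the players draw their actions independently of each other
according to `σ`. -/
def playProb (σ : M.DrawRule) : ∀ t, M.Play t → ℝ
  | 0, ω => M.initProb ω.1 ω.2
  | t + 1, ω => playProb σ t ω.1 * (∏ i, ∏ j, σ t ω.1 i j (ω.2.1 i j)) *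
      M.stepProb t (M.state t ω.1) ω.2.1 ω.2.2.1 ω.2.2.2

/-! ### The original game -/

/-- Behavioral strategies of Team `i`: Player `j` uses the common information and its own private
information. -/
abbrev Strategy (i : Fin 2) : Type u :=
  ∀ t, ∀ j, M.Common t → M.P t i j → stdSimplex ℝ (M.U t i j)

/-- The distributions used by the players under a strategy profile. -/
def draw (g₁ : M.Strategy 0) (g₂ : M.Strategy 1) : M.DrawRule := fun t ω i =>
  match i with
  | 0 => fun j => g₁ t j (M.common t ω) (M.priv t ω 0 j)
  | 1 => fun j => g₂ t j (M.common t ω) (M.priv t ω 1 j)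

/-- Total expected cost. -/
def J (g₁ : M.Strategy 0) (g₂ : M.Strategy 1) : ℝ :=
  ∑ ω : M.Play M.T, M.playProb (M.draw g₁ g₂) M.T ω * M.totalCost M.T ω

/-- The upper value of the game. -/
def upperValue : ℝ := ⨅ g₁ : M.Strategy 0, ⨆ g₂ : M.Strategy 1, M.J g₁ g₂

/-- `g₁` is a min-max strategy of Team 1: its worst-case cost is attained and equals the upper
value. -/
def IsMinMax (g₁ : M.Strategy 0) : Prop :=
  IsGreatest (Set.range fun g₂ : M.Strategy 1 => M.J g₁ g₂) M.upperValue

/-! ### The expanded virtual game and the common information belief -/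

/-- Prescriptions of virtual player `i`. -/
abbrev Presc (t : ℕ) (i : Fin 2) : Type u := ∀ j, M.P t i j → stdSimplex ℝ (M.U t i j)

/-- Histories of the prescriptions of both virtual players at all times before `t`. -/
def PrescHist : ℕ → Type u
  | 0 => PUnit
  | t + 1 => PrescHist t × M.Presc t 0 × M.Presc t 1

/-- Strategies of virtual player `i` in the expanded game. -/
abbrev VStrategy (i : Fin 2) : Type u := ∀ t, M.Common t → M.PrescHist t → M.Presc t i

variable {M} in
/-- The prescriptions used before time `t` along a trajectory. -/
def prescHist (χ₁ : M.VStrategy 0) (χ₂ : M.VStrategy 1) : ∀ t, M.Play t → M.PrescHist t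
  | 0, _ => PUnit.unit
  | t + 1, ω =>
    (prescHist χ₁ χ₂ t ω.1,
      χ₁ t (M.common t ω.1) (prescHist χ₁ χ₂ t ω.1),
      χ₂ t (M.common t ω.1) (prescHist χ₁ χ₂ t ω.1))

/-- The distributions used to draw the actions in the expanded game. -/
def vdraw (χ₁ : M.VStrategy 0) (χ₂ : M.VStrategy 1) : M.DrawRule := fun t ω i =>
  match i with
  | 0 => fun j => χ₁ t (M.common t ω) (prescHist χ₁ χ₂ t ω) j (M.priv t ω 0 j)
  | 1 => fun j => χ₂ t (M.common t ω) (prescHist χ₁ χ₂ t ω) j (M.priv t ω 1 j)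

/-- Distributions of the state and the private informations at time `t`. -/
abbrev Belief (t : ℕ) : Type u := stdSimplex ℝ (M.X t × M.Priv t)

/-- The common information belief on a trajectory: the conditional distribution of the state and
the private informations, given the common information and all past prescriptions. -/
def cib (χ₁ : M.VStrategy 0) (χ₂ : M.VStrategy 1) (t : ℕ) (ω : M.Play t) : M.Belief t :=
  open Classical in
  normalizeWeight fun xp => ∑ ω' : M.Play t,
    if M.state t ω' = xp.1 ∧ M.priv t ω' = xp.2 ∧ M.common t ω' = M.common t ω ∧
        prescHist χ₁ χ₂ t ω' = prescHist χ₁ χ₂ t ω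
    then M.playProb (M.vdraw χ₁ χ₂) t ω' else 0

/-- Belief updates that use the prescription of virtual player 1 only. -/
abbrev Update : Type u := ∀ t, M.Belief t → M.Presc t 0 → M.Z (t + 1) → M.Belief (t + 1)

/-- Under every strategy profile of the expanded game, the common information belief evolves
almost surely according to `F`. -/
def IsCIBUpdate (F : M.Update) : Prop :=
  ∀ (χ₁ : M.VStrategy 0) (χ₂ : M.VStrategy 1) (t : ℕ), t + 1 < M.T → ∀ ω : M.Play (t + 1),
    0 < M.playProb (M.vdraw χ₁ χ₂) (t + 1) ω →
      M.cib χ₁ χ₂ (t + 1) ω =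
        F t (M.cib χ₁ χ₂ t ω.1)
          (χ₁ t (M.common t ω.1) (prescHist χ₁ χ₂ t ω.1))
          (M.incr (t + 1) ω)

/-! ### The min-max dynamic program -/

variable {M} in
/-- Probability of the actions `a`, given the prescriptions and the private informations. -/
def actProb {t : ℕ} (γ₁ : M.Presc t 0) (γ₂ : M.Presc t 1) (p : M.Priv t) (a : M.Act t) : ℝ :=
  (∏ j, γ₁ j (p 0 j) (a 0 j)) * ∏ j, γ₂ j (p 1 j) (a 1 j)

/-- Expected instantaneous cost. -/
def stageCost (t : ℕ) (π : M.Belief t) (γ₁ : M.Presc t 0) (γ₂ : M.Presc t 1) : ℝ :=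
  ∑ x, ∑ p, ∑ a, M.c t x a * π (x, p) * actProb γ₁ γ₂ p a

/-- Probability of the next increment of the common information, when the current state and
private informations have distribution `π`. -/
def incrProb (t : ℕ) (π : M.Belief t) (γ₁ : M.Presc t 0) (γ₂ : M.Presc t 1)
    (z : M.Z (t + 1)) : ℝ :=
  open Classical in
  ∑ x, ∑ p, ∑ a, π (x, p) * actProb γ₁ γ₂ p a *
    ∑ x', ∑ y', if M.ζ t p a y' = z then M.stepProb t x a x' y' else 0

/-- The upper cost-to-go, for a given value function of the next time. -/
def costToGo (F : M.Update) (t : ℕ) (V : M.Belief (t + 1) → ℝ) (π : M.Belief t)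
    (γ₁ : M.Presc t 0) (γ₂ : M.Presc t 1) : ℝ :=
  M.stageCost t π γ₁ γ₂ + ∑ z, M.incrProb t π γ₁ γ₂ z * V (F t π γ₁ z)

/-- The upper value function at time `t` when `k` stages remain. -/
def valueToGo (F : M.Update) : ℕ → ∀ t, M.Belief t → ℝ
  | 0, _, _ => 0
  | k + 1, t, π =>
    ⨅ γ₁ : M.Presc t 0, ⨆ γ₂ : M.Presc t 1, M.costToGo F t (valueToGo F k (t + 1)) π γ₁ γ₂

/-- The upper value function; it vanishes after the horizon. -/
def V (F : M.Update) (t : ℕ) (π : M.Belief t) : ℝ := M.valueToGo F (M.T - t) t π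

/-- The upper cost-to-go function. -/
def w (F : M.Update) (t : ℕ) (π : M.Belief t) (γ₁ : M.Presc t 0) (γ₂ : M.Presc t 1) : ℝ :=
  M.costToGo F t (M.V F (t + 1)) π γ₁ γ₂

/-- `Ξ` selects, at every time and every belief, a prescription of virtual player 1 that attains
the minimum in the dynamic program. -/
def IsDPMinimizer (F : M.Update) (Ξ : ∀ t, M.Belief t → M.Presc t 0) : Prop :=
  ∀ t, t < M.T → ∀ π : M.Belief t,
    IsGreatest (Set.range fun γ₂ : M.Presc t 1 => M.w F t π (Ξ t π) γ₂) (M.V F t π)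

/-! ### The algorithm -/

/-- The conditional distribution of the initial state and private informations, given the initial
common information. -/
def initBelief (z : M.Z 0) : M.Belief 0 :=
  open Classical in
  normalizeWeight fun xp => ∑ y : M.Obs 0,
    if M.ξ₀ y = xp.2 ∧ M.ζ₀ y = z then M.initProb xp.1 y else 0

variable {M} in
/-- The belief tracked by the algorithm from the common information. -/
def trackedBelief (F : M.Update) (Ξ : ∀ t, M.Belief t → M.Presc t 0) :
    ∀ t, M.Common t → M.Belief t
  | 0, z => M.initBelief z
  | t + 1, cz => F t (trackedBelief F Ξ t cz.1) (Ξ t (trackedBelief F Ξ t cz.1)) cz.2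

variable {M} in
/-- The strategy computed by the algorithm: each player tracks the belief, computes the
prescription, and applies its component of it to its own private information. -/
def algorithmStrategy (F : M.Update) (Ξ : ∀ t, M.Belief t → M.Presc t 0) : M.Strategy 0 :=
  fun t j c p => Ξ t (trackedBelief F Ξ t c) j p

end TeamGame

end

noncomputable section

/-! Optimality. By the Assumption, the belief is computable from the common information and Team 1's
prescriptions, whatever Team 2 does. Given an update rule and a profile, let the potential at time
`t` be the expected cost before `t` plus the expectation of `V` at the belief computed this way. The
tower property (`potential_succ`) says that the next potential arises by replacing `V` with `w` at
the prescriptions in use. The potential starts at a number independent of both strategies,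
`expectedInitialValue`, and ends at `J`. If Team 1 follows a minimizer, then `w ≤ V` and the
potential never increases. Against any strategy of Team 1, Team 2 can pick for each common
information a prescription with `V ≤ w`, so that the potential never decreases. Hence the initial
number is the upper value, and the algorithm attains it.

Existence. An update rule is unconstrained at unreachable beliefs, so its program may be too
irregular to have a minimizer. The Bayes rule for uniform play of Team 2, `bayesUpdate`, is a better
choice. It is an update rule because uniform play keeps every possible event possible and, by the
Assumption, the posterior does not depend on Team 2's prescription (`isCIBUpdate_bayesUpdate`). It
can be discontinuous only where the increment has probability zero, and there the weight in front of
the bounded function `V` vanishes too (`continuous_costToGo_bayesUpdate`). Compactness of the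
prescription sets then yields a minimizer. -/

/-! ### Normalized weights and finite distributions -/

theorem normalizeWeight_apply {A : Type u} [Fintype A] [Nonempty A] {w : A → ℝ}
    (h₀ : ∀ a, 0 ≤ w a) (h : 0 < ∑ a, w a) (a : A) :
    normalizeWeight w a = w a / ∑ b, w b := by
  rw [normalizeWeight, dif_pos ⟨h₀, h⟩]
  rfl

/-- Lets the probability of the conditioning event drop out of Bayes' rule in `cib_succ`. Scaling by
`k > 0` does not change which branch of the definition applies. -/
theorem normalizeWeight_const_mul {A : Type u} [Fintype A] [Nonempty A] {k : ℝ} (hk : 0 < k)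
    (w : A → ℝ) : normalizeWeight (fun a => k * w a) = normalizeWeight w := by
  have e : ((∀ a, 0 ≤ k * w a) ∧ 0 < ∑ a, k * w a) ↔ ((∀ a, 0 ≤ w a) ∧ 0 < ∑ a, w a) := by
    rw [← Finset.mul_sum]
    simp only [mul_nonneg_iff_of_pos_left hk, mul_pos_iff_of_pos_left hk]
  unfold normalizeWeight
  by_cases h : (∀ a, 0 ≤ w a) ∧ 0 < ∑ a, w a
  · rw [dif_pos h, dif_pos (e.2 h)]
    refine Subtype.ext (funext fun a => ?_)
    change k * w a / ∑ b, k * w b = w a / ∑ b, w b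
    rw [← Finset.mul_sum, mul_div_mul_left _ _ hk.ne']
  · rw [dif_neg h, dif_neg (fun h' => h (e.1 h'))]

theorem stdSimplex.continuous_apply {A : Type u} [Fintype A] (a : A) :
    Continuous fun s : stdSimplex ℝ A => s a :=
  (_root_.continuous_apply a).comp continuous_subtype_val

/-- The total weight stays positive near `b`, so the quotient formula holds on a neighbourhood.
Nothing is claimed where the total is zero. -/
theorem continuousAt_normalizeWeight {A : Type u} [Fintype A] [Nonempty A]
    {B : Type*} [TopologicalSpace B] {w : B → A → ℝ} {b : B}
    (h₀ : ∀ b a, 0 ≤ w b a) (hw : ∀ a, Continuous fun b => w b a) (h : 0 < ∑ a, w b a) :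
    ContinuousAt (fun b => normalizeWeight (w b)) b := by
  have hs : Continuous fun b => ∑ a, w b a := continuous_finsetSum _ fun a _ => hw a
  rw [Topology.IsInducing.subtypeVal.continuousAt_iff, continuousAt_pi]
  intro a
  have hc : ContinuousAt (fun b => w b a / ∑ a, w b a) b :=
    (hw a).continuousAt.div hs.continuousAt h.ne'
  refine hc.congr ?_
  filter_upwards [hs.continuousAt.eventually (lt_mem_nhds h)] with b' hb'
  exact (normalizeWeight_apply (h₀ b') hb' a).symm

theorem sum_prod_prod {ι : Type*} [Fintype ι] [DecidableEq ι] {κ : ι → Type*}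
    [∀ i, Fintype (κ i)] [∀ i, DecidableEq (κ i)] {A : ∀ i, κ i → Type*}
    [∀ i j, Fintype (A i j)] (q : ∀ i j, A i j → ℝ) :
    ∑ y : ∀ i j, A i j, ∏ i, ∏ j, q i j (y i j) = ∏ i, ∏ j, ∑ a, q i j a := by
  simp_rw [Fintype.prod_sum]

theorem sum_sum_ite_eq {A B : Type*} [Fintype A] [Fintype B] (s : stdSimplex ℝ A) (k : A → B)
    [DecidableEq B] : ∑ b, ∑ a, (if k a = b then s a else 0) = 1 := by
  rw [Finset.sum_comm]
  simp

namespace TeamGame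

variable (M : TeamGame.{u})

/-! ### Probabilities of trajectories and boundedness of the cost -/

theorem initProb_nonneg (x : M.X 0) (y : M.Obs 0) : 0 ≤ M.initProb x y := by
  classical
  unfold initProb
  refine mul_nonneg (stdSimplex.zero_le _ _) (Finset.prod_nonneg fun i _ =>
    Finset.prod_nonneg fun j _ => Finset.sum_nonneg fun w _ => ?_)
  split_ifs
  exacts [stdSimplex.zero_le _ _, le_rfl]

theorem stepProb_nonneg (t : ℕ) (x : M.X t) (a : M.Act t) (x' : M.X (t + 1))
    (y' : M.Obs (t + 1)) : 0 ≤ M.stepProb t x a x' y' := by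
  classical
  unfold stepProb
  refine mul_nonneg (Finset.sum_nonneg fun w _ => ?_) (Finset.prod_nonneg fun i _ =>
    Finset.prod_nonneg fun j _ => Finset.sum_nonneg fun w _ => ?_) <;>
  · split_ifs
    exacts [stdSimplex.zero_le _ _, le_rfl]

theorem sum_stepProb (t : ℕ) (x : M.X t) (a : M.Act t) :
    ∑ x', ∑ y', M.stepProb t x a x' y' = 1 := by
  classical
  have h1 : ∀ x', ∑ y', M.stepProb t x a x' y' =
      ∑ w, if M.f t x a w = x' then M.νS t w else 0 := by
    intro x'
    unfold stepProb
    rw [← Finset.mul_sum]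
    have := sum_prod_prod (fun i j (y : M.Y (t + 1) i j) =>
      ∑ w, if M.h t i j x' a w = y then M.νO (t + 1) i j w else 0)
    simp_rw [sum_sum_ite_eq, Finset.prod_const_one] at this
    convert mul_one _
  simp_rw [h1]
  exact sum_sum_ite_eq _ _

theorem playProb_nonneg (σ : M.DrawRule) : ∀ t ω, 0 ≤ M.playProb σ t ω
  | 0, _ => M.initProb_nonneg _ _
  | t + 1, ω => mul_nonneg (mul_nonneg (playProb_nonneg σ t ω.1)
      (Finset.prod_nonneg fun _ _ => Finset.prod_nonneg fun _ _ => stdSimplex.zero_le _ _))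
      (M.stepProb_nonneg _ _ _ _ _)

/-- Dropping the action factors, which are at most `1`, leaves a bound free of `σ`. It makes the
supremum over Team 2's strategies a genuine one. -/
theorem exists_playProb_le : ∀ t, ∃ B : M.Play t → ℝ, ∀ σ ω, M.playProb σ t ω ≤ B ω
  | 0 => ⟨fun ω => M.initProb ω.1 ω.2, fun _ _ => le_rfl⟩
  | t + 1 => by
    obtain ⟨B, hB⟩ := exists_playProb_le t
    refine ⟨fun ω => B ω.1 * M.stepProb t (M.state t ω.1) ω.2.1 ω.2.2.1 ω.2.2.2, fun σ ω => ?_⟩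
    refine mul_le_mul_of_nonneg_right ?_ (M.stepProb_nonneg _ _ _ _ _)
    refine (mul_le_of_le_one_right (M.playProb_nonneg σ t ω.1) ?_).trans (hB σ ω.1)
    exact Finset.prod_le_one
      (fun _ _ => Finset.prod_nonneg fun _ _ => stdSimplex.zero_le _ _)
      fun _ _ => Finset.prod_le_one (fun _ _ => stdSimplex.zero_le _ _)
        fun _ _ => stdSimplex.le_one _ _

theorem bddAbove_range_J (g₁ : M.Strategy 0) : BddAbove (Set.range fun g₂ => M.J g₁ g₂) := by
  obtain ⟨B, hB⟩ := M.exists_playProb_le M.T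
  refine ⟨∑ ω, B ω * |M.totalCost M.T ω|, ?_⟩
  rintro _ ⟨g₂, rfl⟩
  refine Finset.sum_le_sum fun ω _ => ?_
  exact (mul_le_mul_of_nonneg_left (le_abs_self _) (M.playProb_nonneg _ _ _)).trans
    (mul_le_mul_of_nonneg_right (hB _ ω) (abs_nonneg _))

variable {M}

theorem actProb_nonneg {t : ℕ} (γ₁ : M.Presc t 0) (γ₂ : M.Presc t 1) (p : M.Priv t)
    (a : M.Act t) : 0 ≤ actProb γ₁ γ₂ p a :=
  mul_nonneg (Finset.prod_nonneg fun _ _ => stdSimplex.zero_le _ _)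
    (Finset.prod_nonneg fun _ _ => stdSimplex.zero_le _ _)

theorem prod_vdraw (χ₁ : M.VStrategy 0) (χ₂ : M.VStrategy 1) (t : ℕ) (ω : M.Play t)
    (a : M.Act t) :
    ∏ i, ∏ j, M.vdraw χ₁ χ₂ t ω i j (a i j) =
      actProb (χ₁ t (M.common t ω) (prescHist χ₁ χ₂ t ω))
        (χ₂ t (M.common t ω) (prescHist χ₁ χ₂ t ω)) (M.priv t ω) a := by
  rw [Fin.prod_univ_two]
  rfl

theorem sum_actProb {t : ℕ} (γ₁ : M.Presc t 0) (γ₂ : M.Presc t 1) (p : M.Priv t) :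
    ∑ a, actProb γ₁ γ₂ p a = 1 := by
  let q : ∀ i j, stdSimplex ℝ (M.U t i j) := fun i =>
    match i with
    | 0 => fun j => γ₁ j (p 0 j)
    | 1 => fun j => γ₂ j (p 1 j)
  have h := sum_prod_prod fun i j a => q i j a
  simp_rw [stdSimplex.sum_eq_one, Finset.prod_const_one] at h
  rw [← h]
  refine Finset.sum_congr rfl fun a _ => ?_
  rw [Fin.prod_univ_two]
  rfl

variable (M)

/-- One-step disintegration of the trajectory law, the common source of the belief recursion
`cib_succ` and of `potential_succ`. -/
theorem sum_playProb_succ (χ₁ : M.VStrategy 0) (χ₂ : M.VStrategy 1) (t : ℕ)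
    (φ : M.Play (t + 1) → ℝ) :
    ∑ ω, M.playProb (M.vdraw χ₁ χ₂) (t + 1) ω * φ ω =
      ∑ ω, M.playProb (M.vdraw χ₁ χ₂) t ω *
        ∑ a, actProb (χ₁ t (M.common t ω) (prescHist χ₁ χ₂ t ω))
          (χ₂ t (M.common t ω) (prescHist χ₁ χ₂ t ω)) (M.priv t ω) a *
          ∑ x', ∑ y', M.stepProb t (M.state t ω) a x' y' * φ (ω, a, x', y') := by
  simp_rw [← prod_vdraw, Finset.mul_sum]
  change ∑ ω : M.Play t × M.Act t × M.X (t + 1) × M.Obs (t + 1), _ = _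
  simp_rw [Fintype.sum_prod_type]
  refine Finset.sum_congr rfl fun ω _ => Finset.sum_congr rfl fun a _ =>
    Finset.sum_congr rfl fun x' _ => Finset.sum_congr rfl fun y' _ => ?_
  change M.playProb _ t ω * (∏ i, ∏ j, M.vdraw χ₁ χ₂ t ω i j (a i j)) *
    M.stepProb t (M.state t ω) a x' y' * _ = _
  ring

/-! ### Continuity and boundedness of the dynamic program -/

theorem continuous_actProb {t : ℕ} (p : M.Priv t) (a : M.Act t) :
    Continuous fun q : M.Presc t 0 × M.Presc t 1 => actProb q.1 q.2 p a := by
  unfold actProb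
  refine Continuous.mul (continuous_finsetProd _ fun j _ => ?_)
    (continuous_finsetProd _ fun j _ => ?_)
  · have h : Continuous fun q : M.Presc t 0 × M.Presc t 1 => q.1 j (p 0 j) := by fun_prop
    exact (stdSimplex.continuous_apply _).comp h
  · have h : Continuous fun q : M.Presc t 0 × M.Presc t 1 => q.2 j (p 1 j) := by fun_prop
    exact (stdSimplex.continuous_apply _).comp h

theorem continuous_belief_mul_actProb {t : ℕ} (x : M.X t) (p : M.Priv t) (a : M.Act t) :
    Continuous fun q : M.Belief t × M.Presc t 0 × M.Presc t 1 =>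
      q.1 (x, p) * actProb q.2.1 q.2.2 p a :=
  ((stdSimplex.continuous_apply _).comp continuous_fst).mul
    ((M.continuous_actProb p a).comp continuous_snd)

theorem continuous_stageCost (t : ℕ) :
    Continuous fun q : M.Belief t × M.Presc t 0 × M.Presc t 1 =>
      M.stageCost t q.1 q.2.1 q.2.2 := by
  unfold stageCost
  refine continuous_finsetSum _ fun x _ => continuous_finsetSum _ fun p _ =>
    continuous_finsetSum _ fun a _ => ?_
  simp_rw [mul_assoc]
  exact continuous_const.mul (M.continuous_belief_mul_actProb x p a)

theorem continuous_incrProb (t : ℕ) (z : M.Z (t + 1)) :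
    Continuous fun q : M.Belief t × M.Presc t 0 × M.Presc t 1 =>
      M.incrProb t q.1 q.2.1 q.2.2 z := by
  unfold incrProb
  exact continuous_finsetSum _ fun x _ => continuous_finsetSum _ fun p _ =>
    continuous_finsetSum _ fun a _ => (M.continuous_belief_mul_actProb x p a).mul continuous_const

theorem incrProb_nonneg (t : ℕ) (π : M.Belief t) (γ₁ : M.Presc t 0) (γ₂ : M.Presc t 1)
    (z : M.Z (t + 1)) : 0 ≤ M.incrProb t π γ₁ γ₂ z := by
  classical
  unfold incrProb
  refine Finset.sum_nonneg fun x _ => Finset.sum_nonneg fun p _ => Finset.sum_nonneg fun a _ =>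
    mul_nonneg (mul_nonneg (stdSimplex.zero_le _ _) (actProb_nonneg _ _ _ _))
      (Finset.sum_nonneg fun x' _ => Finset.sum_nonneg fun y' _ => ?_)
  split_ifs
  exacts [M.stepProb_nonneg _ _ _ _ _, le_rfl]

/-- Continuity and compactness are used only for the stage cost and the increment probabilities, so
`F` and `V` may be arbitrarily irregular as long as `V` is bounded. -/
theorem exists_abs_costToGo_le (t : ℕ) (K : ℝ) :
    ∃ K', ∀ (F : M.Update) (V : M.Belief (t + 1) → ℝ), (∀ π, |V π| ≤ K) →
      ∀ π γ₁ γ₂, |M.costToGo F t V π γ₁ γ₂| ≤ K' := by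
  obtain ⟨B, hB⟩ := isCompact_univ.exists_bound_of_continuousOn
    (M.continuous_stageCost t).continuousOn
  have hz : ∀ z, ∃ b, ∀ q ∈ Set.univ, _ := fun z =>
    isCompact_univ.exists_bound_of_continuousOn (M.continuous_incrProb t z).continuousOn
  choose b hb using hz
  refine ⟨B + ∑ z, b z * K, fun F V hV π γ₁ γ₂ => (abs_add_le _ _).trans (add_le_add
    (hB (π, γ₁, γ₂) trivial) ((Finset.abs_sum_le_sum_abs _ _).trans
      (Finset.sum_le_sum fun z _ => ?_)))⟩
  have h := hb z (π, γ₁, γ₂) trivial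
  rw [abs_mul]
  exact mul_le_mul h (hV _) (abs_nonneg _) ((norm_nonneg _).trans h)

theorem exists_abs_valueToGo_le (F : M.Update) :
    ∀ k t, ∃ K, ∀ π, |M.valueToGo F k t π| ≤ K
  | 0, _ => ⟨0, fun _ => by simp [valueToGo]⟩
  | k + 1, t => by
    obtain ⟨K, hK⟩ := exists_abs_valueToGo_le F k (t + 1)
    obtain ⟨K', hK'⟩ := M.exists_abs_costToGo_le t K
    refine ⟨K', fun π => ?_⟩
    have h := fun γ₁ γ₂ => abs_le.1 (hK' F _ hK π γ₁ γ₂)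
    have hs : ∀ γ₁, -K' ≤ ⨆ γ₂, M.costToGo F t (M.valueToGo F k (t + 1)) π γ₁ γ₂ := fun γ₁ =>
      le_ciSup_of_le ⟨K', by rintro _ ⟨γ₂, rfl⟩; exact (h γ₁ γ₂).2⟩
        (Classical.arbitrary _) (h γ₁ _).1
    exact abs_le.2 ⟨le_ciInf hs, ciInf_le_of_le ⟨-K', by rintro _ ⟨γ₁, rfl⟩; exact hs γ₁⟩
      (Classical.arbitrary _) (ciSup_le fun γ₂ => (h _ γ₂).2)⟩

theorem V_horizon (F : M.Update) (π : M.Belief M.T) : M.V F M.T π = 0 := by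
  unfold V
  rw [Nat.sub_self]
  rfl

theorem V_eq_iInf_iSup (F : M.Update) {t : ℕ} (ht : t < M.T) (π : M.Belief t) :
    M.V F t π = ⨅ γ₁, ⨆ γ₂, M.w F t π γ₁ γ₂ := by
  have h : M.T - t = (M.T - (t + 1)) + 1 := by omega
  unfold w V
  rw [h]
  rfl

theorem exists_abs_w_le (F : M.Update) (t : ℕ) : ∃ K, ∀ π γ₁ γ₂, |M.w F t π γ₁ γ₂| ≤ K := by
  obtain ⟨K, hK⟩ := M.exists_abs_valueToGo_le F (M.T - (t + 1)) (t + 1)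
  obtain ⟨K', hK'⟩ := M.exists_abs_costToGo_le t K
  exact ⟨K', hK' F _ hK⟩

theorem V_le_iSup_w (F : M.Update) {t : ℕ} (ht : t < M.T) (π : M.Belief t) (γ₁ : M.Presc t 0) :
    M.V F t π ≤ ⨆ γ₂, M.w F t π γ₁ γ₂ := by
  obtain ⟨K, hK⟩ := M.exists_abs_w_le F t
  rw [M.V_eq_iInf_iSup F ht]
  refine ciInf_le ⟨-K, ?_⟩ γ₁
  rintro _ ⟨γ, rfl⟩
  exact le_ciSup_of_le ⟨K, by rintro _ ⟨γ₂, rfl⟩; exact (abs_le.1 (hK _ _ _)).2⟩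
    (Classical.arbitrary _) (abs_le.1 (hK π γ _)).1

/-- The next belief `F t π γ₁ z` does not involve `γ₂`, so the continuation values are constants
here. Team 2's maximum is therefore attained for every `F`, however discontinuous. -/
theorem continuous_w_right (F : M.Update) (t : ℕ) (π : M.Belief t) (γ₁ : M.Presc t 0) :
    Continuous fun γ₂ => M.w F t π γ₁ γ₂ := by
  have h : Continuous fun γ₂ : M.Presc t 1 => (π, γ₁, γ₂) := by fun_prop
  exact ((M.continuous_stageCost t).comp h).add (continuous_finsetSum _ fun z _ =>
    ((M.continuous_incrProb t z).comp h).mul continuous_const)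

theorem exists_isGreatest_w (F : M.Update) (t : ℕ) (π : M.Belief t) (γ₁ : M.Presc t 0) :
    ∃ γ₂, IsGreatest (Set.range fun γ => M.w F t π γ₁ γ) (M.w F t π γ₁ γ₂) := by
  obtain ⟨γ₂, -, h⟩ := isCompact_univ.exists_isMaxOn Set.univ_nonempty
    (M.continuous_w_right F t π γ₁).continuousOn
  refine ⟨γ₂, ⟨γ₂, rfl⟩, ?_⟩
  rintro _ ⟨γ, rfl⟩
  exact h trivial

theorem exists_V_le_w (F : M.Update) {t : ℕ} (ht : t < M.T) (π : M.Belief t)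
    (γ₁ : M.Presc t 0) : ∃ γ₂, M.V F t π ≤ M.w F t π γ₁ γ₂ := by
  obtain ⟨γ₂, h⟩ := M.exists_isGreatest_w F t π γ₁
  exact ⟨γ₂, (M.V_le_iSup_w F ht π γ₁).trans_eq h.csSup_eq⟩

/-! ### The Bayesian update for uniform prescriptions of virtual player 2 -/

/-- The unnormalized posterior distribution of the next state and private informations. -/
def bayesWeight (t : ℕ) (π : M.Belief t) (γ₁ : M.Presc t 0) (γ₂ : M.Presc t 1)
    (z : M.Z (t + 1)) (xp' : M.X (t + 1) × M.Priv (t + 1)) : ℝ :=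
  open Classical in
  ∑ x, ∑ p, ∑ a, π (x, p) * actProb γ₁ γ₂ p a *
    ∑ y', if M.ξ t p a y' = xp'.2 ∧ M.ζ t p a y' = z then M.stepProb t x a xp'.1 y' else 0

theorem bayesWeight_nonneg (t : ℕ) (π : M.Belief t) (γ₁ : M.Presc t 0) (γ₂ : M.Presc t 1)
    (z : M.Z (t + 1)) (xp' : M.X (t + 1) × M.Priv (t + 1)) :
    0 ≤ M.bayesWeight t π γ₁ γ₂ z xp' := by
  classical
  unfold bayesWeight
  refine Finset.sum_nonneg fun x _ => Finset.sum_nonneg fun p _ => Finset.sum_nonneg fun a _ =>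
    mul_nonneg (mul_nonneg (stdSimplex.zero_le _ _) (actProb_nonneg _ _ _ _))
      (Finset.sum_nonneg fun y' _ => ?_)
  split_ifs
  exacts [M.stepProb_nonneg _ _ _ _ _, le_rfl]

theorem sum_bayesWeight (t : ℕ) (π : M.Belief t) (γ₁ : M.Presc t 0) (γ₂ : M.Presc t 1)
    (z : M.Z (t + 1)) : ∑ xp', M.bayesWeight t π γ₁ γ₂ z xp' = M.incrProb t π γ₁ γ₂ z := by
  classical
  unfold bayesWeight incrProb
  rw [Finset.sum_comm]
  refine Finset.sum_congr rfl fun x _ => ?_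
  rw [Finset.sum_comm]
  refine Finset.sum_congr rfl fun p _ => ?_
  rw [Finset.sum_comm]
  refine Finset.sum_congr rfl fun a _ => ?_
  rw [← Finset.mul_sum, Fintype.sum_prod_type]
  congr 1
  refine Finset.sum_congr rfl fun x' _ => ?_
  rw [Finset.sum_comm]
  refine Finset.sum_congr rfl fun y' _ => ?_
  simp only [ite_and]
  rw [Finset.sum_ite_eq]
  simp

theorem continuous_bayesWeight (t : ℕ) (z : M.Z (t + 1))
    (xp' : M.X (t + 1) × M.Priv (t + 1)) :
    Continuous fun q : M.Belief t × M.Presc t 0 × M.Presc t 1 =>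
      M.bayesWeight t q.1 q.2.1 q.2.2 z xp' := by
  unfold bayesWeight
  exact continuous_finsetSum _ fun x _ => continuous_finsetSum _ fun p _ =>
    continuous_finsetSum _ fun a _ => (M.continuous_belief_mul_actProb x p a).mul continuous_const

/-- The prescription that draws all actions uniformly. -/
def uniformPresc (t : ℕ) (i : Fin 2) : M.Presc t i := fun _ _ => stdSimplex.barycenter

/-- The posterior distribution of the next state and private informations when virtual player 2
uses the uniform prescription. -/
def bayesUpdate : M.Update := fun t π γ₁ z =>
  normalizeWeight (M.bayesWeight t π γ₁ (M.uniformPresc t 1) z)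

/-- Uniform play dominates every other prescription, with a constant independent of the belief. -/
theorem exists_mul_actProb_le (t : ℕ) : ∃ κ : ℝ, 0 < κ ∧ ∀ (γ₁ : M.Presc t 0)
    (γ₂ : M.Presc t 1) (p : M.Priv t) (a : M.Act t),
      κ * actProb γ₁ γ₂ p a ≤ actProb γ₁ (M.uniformPresc t 1) p a := by
  -- The probability of each action profile of Team 2 under uniform play; under any other
  -- prescription it is at most `1`.
  refine ⟨∏ j, (Fintype.card (M.U t 1 j) : ℝ)⁻¹,
    Finset.prod_pos fun j _ => inv_pos.2 (Nat.cast_pos.2 Fintype.card_pos),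
    fun γ₁ γ₂ p a => ?_⟩
  have h : ∏ j, M.uniformPresc t 1 j (p 1 j) (a 1 j) =
      ∏ j, (Fintype.card (M.U t 1 j) : ℝ)⁻¹ :=
    Finset.prod_congr rfl fun j _ => stdSimplex.barycenter_apply _
  unfold actProb
  rw [h, mul_left_comm]
  refine mul_le_mul_of_nonneg_left (mul_le_of_le_one_right
      (Finset.prod_nonneg fun j _ => inv_nonneg.2 (Nat.cast_nonneg _))
      (Finset.prod_le_one (fun _ _ => stdSimplex.zero_le _ _) fun _ _ => stdSimplex.le_one _ _))
    (Finset.prod_nonneg fun _ _ => stdSimplex.zero_le _ _)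

theorem exists_mul_incrProb_le (t : ℕ) : ∃ κ : ℝ, 0 < κ ∧ ∀ (π : M.Belief t) (γ₁ : M.Presc t 0)
    (γ₂ : M.Presc t 1) (z : M.Z (t + 1)),
      κ * M.incrProb t π γ₁ γ₂ z ≤ M.incrProb t π γ₁ (M.uniformPresc t 1) z := by
  classical
  obtain ⟨κ, hκ, h⟩ := M.exists_mul_actProb_le t
  refine ⟨κ, hκ, fun π γ₁ γ₂ z => ?_⟩
  unfold incrProb
  simp_rw [Finset.mul_sum (a := κ)]
  refine Finset.sum_le_sum fun x _ => Finset.sum_le_sum fun p _ => Finset.sum_le_sum fun a _ => ?_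
  rw [← mul_assoc, mul_left_comm]
  refine mul_le_mul_of_nonneg_right
    (mul_le_mul_of_nonneg_left (h _ _ _ _) (stdSimplex.zero_le _ _))
    (Finset.sum_nonneg fun x' _ => Finset.sum_nonneg fun y' _ => ?_)
  split_ifs
  exacts [M.stepProb_nonneg _ _ _ _ _, le_rfl]

theorem continuousAt_bayesUpdate (t : ℕ) (z : M.Z (t + 1)) {q : M.Belief t × M.Presc t 0}
    (h : 0 < M.incrProb t q.1 q.2 (M.uniformPresc t 1) z) :
    ContinuousAt (fun q : M.Belief t × M.Presc t 0 => M.bayesUpdate t q.1 q.2 z) q := by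
  have hu : Continuous fun q : M.Belief t × M.Presc t 0 =>
      (q.1, q.2, M.uniformPresc t 1) := by fun_prop
  have hw : ∀ xp', Continuous fun q : M.Belief t × M.Presc t 0 =>
      M.bayesWeight t q.1 q.2 (M.uniformPresc t 1) z xp' := fun xp' => by
    have := (M.continuous_bayesWeight t z xp').comp hu
    exact this
  rw [← sum_bayesWeight] at h
  have h₀ : ∀ (q : M.Belief t × M.Presc t 0) xp',
      0 ≤ M.bayesWeight t q.1 q.2 (M.uniformPresc t 1) z xp' :=
    fun _ _ => M.bayesWeight_nonneg _ _ _ _ _ _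
  have key := continuousAt_normalizeWeight h₀ hw h
  exact key

/-! ### Continuity of the Bayesian dynamic program and existence of a minimizer -/

theorem continuous_costToGo_bayesUpdate (t : ℕ) {V : M.Belief (t + 1) → ℝ} (hV : Continuous V) :
    Continuous fun q : M.Belief t × M.Presc t 0 × M.Presc t 1 =>
      M.costToGo M.bayesUpdate t V q.1 q.2.1 q.2.2 := by
  refine (M.continuous_stageCost t).add (continuous_finsetSum _ fun z _ => ?_)
  obtain ⟨κ, hκ, hle⟩ := M.exists_mul_incrProb_le t
  obtain ⟨K, hK⟩ := isCompact_univ.exists_bound_of_continuousOn hV.continuousOn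
  have hu : Continuous fun q : M.Belief t × M.Presc t 0 × M.Presc t 1 =>
      (q.1, q.2.1, M.uniformPresc t 1) := by fun_prop
  have hi := (M.continuous_incrProb t z).comp hu
  refine continuous_iff_continuousAt.2 fun q => ?_
  rcases (M.incrProb_nonneg t q.1 q.2.1 (M.uniformPresc t 1) z).lt_or_eq with h | h
  · have hb : ContinuousAt (fun q : M.Belief t × M.Presc t 0 × M.Presc t 1 =>
        M.bayesUpdate t q.1 q.2.1 z) q := by
      exact ContinuousAt.comp (f := fun q : M.Belief t × M.Presc t 0 × M.Presc t 1 => (q.1, q.2.1))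
        (g := fun q : M.Belief t × M.Presc t 0 => M.bayesUpdate t q.1 q.2 z)
        (M.continuousAt_bayesUpdate t z h) (by fun_prop)
    exact (M.continuous_incrProb t z).continuousAt.mul
      (ContinuousAt.comp (g := V) hV.continuousAt hb)
  -- The posterior may jump here. By domination the increment is impossible under every `γ₂`, and
  -- nearby its probability is at most `κ⁻¹` times the one under uniform play, which tends to zero;
  -- `V` is bounded by `K`.
  · have h0 : M.incrProb t q.1 q.2.1 q.2.2 z = 0 :=
      le_antisymm (nonpos_of_mul_nonpos_right ((hle _ _ _ _).trans_eq h.symm) hκ)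
        (M.incrProb_nonneg _ _ _ _ _)
    have hlim : Filter.Tendsto (fun q' : M.Belief t × M.Presc t 0 × M.Presc t 1 =>
        κ⁻¹ * M.incrProb t q'.1 q'.2.1 (M.uniformPresc t 1) z * K) (nhds q) (nhds 0) := by
      have := ((hi.const_mul κ⁻¹).mul_const K).tendsto q
      simpa [← h] using this
    unfold ContinuousAt
    beta_reduce
    rw [h0, zero_mul]
    refine squeeze_zero_norm (fun q' => ?_) hlim
    rw [norm_mul]
    refine mul_le_mul ?_ (hK _ trivial) (norm_nonneg _)
      (mul_nonneg (inv_nonneg.2 hκ.le) (M.incrProb_nonneg _ _ _ _ _))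
    rw [Real.norm_of_nonneg (M.incrProb_nonneg _ _ _ _ _), le_inv_mul_iff₀ hκ]
    exact hle _ _ _ _

theorem continuous_iSup_of_compactSpace {A B : Type*} [TopologicalSpace A] [TopologicalSpace B]
    [CompactSpace B] {f : A → B → ℝ} (hf : Continuous fun q : A × B => f q.1 q.2) :
    Continuous fun a => ⨆ b, f a b := by
  have := isCompact_univ.continuous_sSup (f := f) (K := Set.univ) hf
  simpa only [Set.image_univ, sSup_range] using this

theorem continuous_iInf_of_compactSpace {A B : Type*} [TopologicalSpace A] [TopologicalSpace B]
    [CompactSpace B] {f : A → B → ℝ} (hf : Continuous fun q : A × B => f q.1 q.2) :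
    Continuous fun a => ⨅ b, f a b := by
  have := isCompact_univ.continuous_sInf (f := f) (K := Set.univ) hf
  simpa only [Set.image_univ, sInf_range] using this

theorem continuous_iSup_costToGo_bayesUpdate (t : ℕ) {V : M.Belief (t + 1) → ℝ}
    (hV : Continuous V) : Continuous fun q : M.Belief t × M.Presc t 0 =>
      ⨆ γ₂, M.costToGo M.bayesUpdate t V q.1 q.2 γ₂ := by
  refine continuous_iSup_of_compactSpace
    (f := fun (q : M.Belief t × M.Presc t 0) γ₂ => M.costToGo M.bayesUpdate t V q.1 q.2 γ₂) ?_
  exact (M.continuous_costToGo_bayesUpdate t hV).comp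
    (g := fun q => M.costToGo M.bayesUpdate t V q.1 q.2.1 q.2.2)
    (f := fun q : (M.Belief t × M.Presc t 0) × M.Presc t 1 => (q.1.1, q.1.2, q.2)) (by fun_prop)

theorem continuous_valueToGo_bayesUpdate :
    ∀ k t, Continuous fun π => M.valueToGo M.bayesUpdate k t π
  | 0, _ => continuous_const
  | k + 1, t => continuous_iInf_of_compactSpace
      (M.continuous_iSup_costToGo_bayesUpdate t (continuous_valueToGo_bayesUpdate k (t + 1)))

theorem exists_isDPMinimizer_bayesUpdate : ∃ Ξ, M.IsDPMinimizer M.bayesUpdate Ξ := by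
  -- The bound on `t` stands inside the existential so that the choice below is defined at all
  -- times.
  have key : ∀ t, ∀ π : M.Belief t, ∃ γ₁, t < M.T →
      IsGreatest (Set.range fun γ₂ => M.w M.bayesUpdate t π γ₁ γ₂) (M.V M.bayesUpdate t π) := by
    intro t π
    have hV : Continuous (M.V M.bayesUpdate (t + 1)) :=
      M.continuous_valueToGo_bayesUpdate (M.T - (t + 1)) (t + 1)
    have hc : Continuous fun γ₁ => ⨆ γ₂, M.w M.bayesUpdate t π γ₁ γ₂ := by
      have h := M.continuous_iSup_costToGo_bayesUpdate t hV
      have h' : Continuous fun γ₁ : M.Presc t 0 => (π, γ₁) := Continuous.prodMk_right π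
      have h'' := h.comp h'
      unfold w
      exact h''
    obtain ⟨γ₁, -, hγ₁⟩ := isCompact_univ.exists_isMinOn Set.univ_nonempty hc.continuousOn
    refine ⟨γ₁, fun ht => ?_⟩
    have hV : M.V M.bayesUpdate t π = ⨆ γ₂, M.w M.bayesUpdate t π γ₁ γ₂ := by
      refine le_antisymm (M.V_le_iSup_w _ ht π γ₁) ?_
      rw [M.V_eq_iInf_iSup _ ht]
      exact le_ciInf fun γ => hγ₁ (Set.mem_univ γ)
    obtain ⟨γ₂, h⟩ := M.exists_isGreatest_w M.bayesUpdate t π γ₁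
    rw [hV]
    rwa [← h.csSup_eq] at h
  choose Ξ hΞ using key
  exact ⟨Ξ, fun t ht π => hΞ t π ht⟩

/-! ### Recursion for the common information belief -/

/-- Probability that the common information and the prescription history are those of `ω`. -/
def classProb (χ₁ : M.VStrategy 0) (χ₂ : M.VStrategy 1) (t : ℕ) (ω : M.Play t) : ℝ :=
  open Classical in
  ∑ ω' : M.Play t, if M.common t ω' = M.common t ω ∧ prescHist χ₁ χ₂ t ω' = prescHist χ₁ χ₂ t ω
    then M.playProb (M.vdraw χ₁ χ₂) t ω' else 0

theorem classProb_pos {χ₁ : M.VStrategy 0} {χ₂ : M.VStrategy 1} {t : ℕ} {ω : M.Play t}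
    (hω : 0 < M.playProb (M.vdraw χ₁ χ₂) t ω) : 0 < M.classProb χ₁ χ₂ t ω := by
  classical
  unfold classProb
  refine Finset.sum_pos' (fun ω' _ => ?_) ⟨ω, Finset.mem_univ _, ?_⟩
  · split_ifs
    exacts [M.playProb_nonneg _ _ _, le_rfl]
  · rwa [if_pos ⟨rfl, rfl⟩]

open Classical in
theorem classProb_mul_cib {χ₁ : M.VStrategy 0} {χ₂ : M.VStrategy 1} {t : ℕ} {ω : M.Play t}
    (hω : 0 < M.playProb (M.vdraw χ₁ χ₂) t ω) (xp : M.X t × M.Priv t) :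
    M.classProb χ₁ χ₂ t ω * M.cib χ₁ χ₂ t ω xp = ∑ ω' : M.Play t,
      if M.state t ω' = xp.1 ∧ M.priv t ω' = xp.2 ∧ M.common t ω' = M.common t ω ∧
        prescHist χ₁ χ₂ t ω' = prescHist χ₁ χ₂ t ω
      then M.playProb (M.vdraw χ₁ χ₂) t ω' else 0 := by
  have hsum : ∑ xp : M.X t × M.Priv t, (∑ ω' : M.Play t,
      if M.state t ω' = xp.1 ∧ M.priv t ω' = xp.2 ∧ M.common t ω' = M.common t ω ∧
        prescHist χ₁ χ₂ t ω' = prescHist χ₁ χ₂ t ω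
      then M.playProb (M.vdraw χ₁ χ₂) t ω' else 0) = M.classProb χ₁ χ₂ t ω := by
    unfold classProb
    rw [Finset.sum_comm]
    refine Finset.sum_congr rfl fun ω' _ => ?_
    rw [Finset.sum_eq_single (M.state t ω', M.priv t ω')]
    · simp
    · rintro ⟨x, p⟩ - hne
      refine if_neg fun h => hne (Prod.ext h.1.symm h.2.1.symm)
    · simp
  have hpos := M.classProb_pos hω
  unfold cib
  rw [normalizeWeight_apply, hsum, mul_div_cancel₀ _ hpos.ne']
  · intro xp
    refine Finset.sum_nonneg fun ω' _ => ?_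
    split_ifs
    exacts [M.playProb_nonneg _ _ _, le_rfl]
  · rw [hsum]
    exact hpos

open Classical in
-- The defining property of conditional expectation, with the denominator cleared: on one
-- information class, `cib` averages functions of the state and the private informations.
theorem sum_class_eq_classProb_mul {χ₁ : M.VStrategy 0} {χ₂ : M.VStrategy 1} {t : ℕ}
    {ω : M.Play t} (hω : 0 < M.playProb (M.vdraw χ₁ χ₂) t ω) (H : M.X t × M.Priv t → ℝ) :
    ∑ ω', M.playProb (M.vdraw χ₁ χ₂) t ω' *
      (if M.common t ω' = M.common t ω ∧ prescHist χ₁ χ₂ t ω' = prescHist χ₁ χ₂ t ω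
        then H (M.state t ω', M.priv t ω') else 0) =
      M.classProb χ₁ χ₂ t ω * ∑ xp, M.cib χ₁ χ₂ t ω xp * H xp := by
  rw [Finset.mul_sum]
  simp_rw [← mul_assoc, M.classProb_mul_cib hω, Finset.sum_mul]
  rw [Finset.sum_comm]
  refine Finset.sum_congr rfl fun ω' _ => ?_
  rw [Finset.sum_eq_single (M.state t ω', M.priv t ω')]
  · simp
  · rintro ⟨x, p⟩ - hne
    rw [if_neg fun h => hne (Prod.ext h.1.symm h.2.1.symm), zero_mul]
  · simp

theorem playProb_pos_of_succ {σ : M.DrawRule} {t : ℕ} {ω : M.Play (t + 1)}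
    (hω : 0 < M.playProb σ (t + 1) ω) : 0 < M.playProb σ t ω.1 := by
  refine (M.playProb_nonneg σ t ω.1).lt_of_ne fun h => hω.ne' ?_
  change M.playProb σ t ω.1 * _ * _ = 0
  rw [← h, zero_mul, zero_mul]

/-- Bayes' rule. All trajectories of an information class share the same prescriptions, so the new
class is determined by the old one together with the new increment. -/
theorem cib_succ {χ₁ : M.VStrategy 0} {χ₂ : M.VStrategy 1} {t : ℕ} {ω : M.Play (t + 1)}
    (hω : 0 < M.playProb (M.vdraw χ₁ χ₂) (t + 1) ω) :
    M.cib χ₁ χ₂ (t + 1) ω = normalizeWeight (M.bayesWeight t (M.cib χ₁ χ₂ t ω.1)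
      (χ₁ t (M.common t ω.1) (prescHist χ₁ χ₂ t ω.1))
      (χ₂ t (M.common t ω.1) (prescHist χ₁ χ₂ t ω.1)) (M.incr (t + 1) ω)) := by
  classical
  have hω' := M.playProb_pos_of_succ hω
  rw [← normalizeWeight_const_mul (M.classProb_pos hω')]
  unfold cib
  congr 1
  funext xp'
  set γ₁ := χ₁ t (M.common t ω.1) (prescHist χ₁ χ₂ t ω.1) with hγ₁
  set γ₂ := χ₂ t (M.common t ω.1) (prescHist χ₁ χ₂ t ω.1) with hγ₂
  have h := M.sum_class_eq_classProb_mul hω' fun xp : M.X t × M.Priv t =>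
    ∑ a, actProb γ₁ γ₂ xp.2 a * ∑ y', if M.ξ t xp.2 a y' = xp'.2 ∧
      M.ζ t xp.2 a y' = M.incr (t + 1) ω then M.stepProb t xp.1 a xp'.1 y' else 0
  have hb : M.bayesWeight t (M.cib χ₁ χ₂ t ω.1) γ₁ γ₂ (M.incr (t + 1) ω) xp' =
      ∑ xp, M.cib χ₁ χ₂ t ω.1 xp * ∑ a, actProb γ₁ γ₂ xp.2 a *
        ∑ y', if M.ξ t xp.2 a y' = xp'.2 ∧ M.ζ t xp.2 a y' = M.incr (t + 1) ω
          then M.stepProb t xp.1 a xp'.1 y' else 0 := by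
    unfold bayesWeight
    rw [Fintype.sum_prod_type]
    refine Finset.sum_congr rfl fun x _ => Finset.sum_congr rfl fun p _ => ?_
    rw [Finset.mul_sum]
    exact Finset.sum_congr rfl fun a _ => mul_assoc _ _ _
  change _ = M.classProb χ₁ χ₂ t ω.1 * M.bayesWeight t (M.cib χ₁ χ₂ t ω.1) γ₁ γ₂ _ xp'
  rw [hb, ← h]
  have hs := M.sum_playProb_succ χ₁ χ₂ t fun ω' =>
    if M.state (t + 1) ω' = xp'.1 ∧ M.priv (t + 1) ω' = xp'.2 ∧
      M.common (t + 1) ω' = M.common (t + 1) ω ∧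
      prescHist χ₁ χ₂ (t + 1) ω' = prescHist χ₁ χ₂ (t + 1) ω then 1 else 0
  simp_rw [mul_ite, mul_one, mul_zero] at hs
  rw [hs]
  refine Finset.sum_congr rfl fun ω' _ => ?_
  congr 1
  -- A trajectory outside the old class cannot enter the new one, because common information and
  -- prescription history are never forgotten.
  by_cases hc : M.common t ω' = M.common t ω.1 ∧
      prescHist χ₁ χ₂ t ω' = prescHist χ₁ χ₂ t ω.1
  · rw [if_pos hc]
    refine Finset.sum_congr rfl fun a _ => ?_
    rw [hc.1, hc.2]
    congr 1
    rw [Finset.sum_comm]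
    refine Finset.sum_congr rfl fun y' _ => ?_
    rw [Finset.sum_eq_single xp'.1]
    · refine if_congr ?_ rfl rfl
      constructor
      · rintro ⟨-, h2, h3, -⟩
        exact ⟨h2, congrArg Prod.snd h3⟩
      · rintro ⟨h2, h3⟩
        refine ⟨rfl, h2, Prod.ext hc.1 h3, ?_⟩
        change (_, _, _) = (_, _, _)
        rw [hc.1, hc.2]
    · rintro x' - hne
      exact if_neg fun h => hne h.1
    · simp
  · rw [if_neg hc]
    refine Finset.sum_eq_zero fun a _ => ?_
    rw [Finset.sum_eq_zero, mul_zero]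
    refine fun x' _ => Finset.sum_eq_zero fun y' _ => if_neg ?_
    rintro ⟨-, -, h3, h4⟩
    exact hc ⟨congrArg Prod.fst h3, congrArg Prod.fst h4⟩

/-! ### The Bayesian update is an update rule -/

/-- Causality: with the next two lemmas, it allows virtual player 2's prescription at time `t` to be
replaced without disturbing the belief at time `t`. -/
theorem prescHist_congr {χ₁ : M.VStrategy 0} {χ₂ χ₂' : M.VStrategy 1} :
    ∀ {t : ℕ}, (∀ s < t, χ₂ s = χ₂' s) → ∀ ω, prescHist χ₁ χ₂ t ω = prescHist χ₁ χ₂' t ω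
  | 0, _, _ => rfl
  | t + 1, h, ω => by
    have ih := prescHist_congr (χ₁ := χ₁) (fun s hs => h s (hs.trans (Nat.lt_succ_self t))) ω.1
    change (_, _, _) = (_, _, _)
    rw [ih, h t (Nat.lt_succ_self t)]

theorem playProb_congr {χ₁ : M.VStrategy 0} {χ₂ χ₂' : M.VStrategy 1} :
    ∀ {t : ℕ}, (∀ s < t, χ₂ s = χ₂' s) →
      ∀ ω, M.playProb (M.vdraw χ₁ χ₂) t ω = M.playProb (M.vdraw χ₁ χ₂') t ω
  | 0, _, _ => rfl
  | t + 1, h, ω => by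
    have h' : ∀ s < t, χ₂ s = χ₂' s := fun s hs => h s (hs.trans (Nat.lt_succ_self t))
    have ih := playProb_congr (χ₁ := χ₁) h' ω.1
    change M.playProb _ t ω.1 * (∏ i, ∏ j, _) * _ = M.playProb _ t ω.1 * (∏ i, ∏ j, _) * _
    rw [prod_vdraw, prod_vdraw, ih, M.prescHist_congr h', h t (Nat.lt_succ_self t)]

theorem cib_congr {χ₁ : M.VStrategy 0} {χ₂ χ₂' : M.VStrategy 1} {t : ℕ}
    (h : ∀ s < t, χ₂ s = χ₂' s) (ω : M.Play t) : M.cib χ₁ χ₂ t ω = M.cib χ₁ χ₂' t ω := by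
  have h₁ : prescHist χ₁ χ₂ t = prescHist χ₁ χ₂' t := funext (M.prescHist_congr h)
  have h₂ : M.playProb (M.vdraw χ₁ χ₂) t = M.playProb (M.vdraw χ₁ χ₂') t :=
    funext (M.playProb_congr h)
  unfold cib
  rw [h₁, h₂]

theorem isCIBUpdate_bayesUpdate (hM : ∃ F : M.Update, M.IsCIBUpdate F) :
    M.IsCIBUpdate M.bayesUpdate := by
  obtain ⟨G, hG⟩ := hM
  intro χ₁ χ₂ t ht ω hω
  -- Deviate to uniform play at time `t` only. By domination, `ω` keeps positive probability.
  let χ₂' : M.VStrategy 1 := Function.update χ₂ t fun _ _ => M.uniformPresc t 1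
  have hχ : ∀ s < t, χ₂ s = χ₂' s := fun s hs => (Function.update_of_ne hs.ne _ _).symm
  have hχt : ∀ c ph, χ₂' t c ph = M.uniformPresc t 1 := fun c ph => by
    simp only [χ₂', Function.update_self]
  have hω' : 0 < M.playProb (M.vdraw χ₁ χ₂') (t + 1) ω := by
    obtain ⟨κ, hκ, hle⟩ := M.exists_mul_actProb_le t
    change 0 < M.playProb _ t ω.1 * (∏ i, ∏ j, _) * _ at hω ⊢
    rw [prod_vdraw] at hω ⊢
    rw [← M.playProb_congr hχ, ← M.prescHist_congr hχ, hχt]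
    refine (mul_pos hκ hω).trans_le ?_
    rw [← mul_assoc, mul_left_comm]
    exact mul_le_mul_of_nonneg_right (mul_le_mul_of_nonneg_left (hle _ _ _ _)
      (M.playProb_nonneg _ _ _)) (M.stepProb_nonneg _ _ _ _ _)
  have h := M.cib_succ hω'
  rw [hχt] at h
  -- The given rule `G` is applied twice: it does not see the deviation, so both profiles have the
  -- same belief at time `t + 1`, and under the deviation that belief is the Bayes posterior for
  -- uniform play.
  rw [hG χ₁ χ₂ t ht ω hω, M.cib_congr hχ, M.prescHist_congr hχ, ← hG χ₁ χ₂' t ht ω hω', h]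
  rfl

/-! ### The original game as a part of the expanded game -/

variable {M} in
/-- A strategy of the original game, as a strategy of the expanded game that ignores the
prescription history. -/
def liftStrategy {i : Fin 2} (g : M.Strategy i) : M.VStrategy i := fun t c _ j p => g t j c p

theorem vdraw_liftStrategy (g₁ : M.Strategy 0) (g₂ : M.Strategy 1) :
    M.vdraw (liftStrategy g₁) (liftStrategy g₂) = M.draw g₁ g₂ := by
  funext t ω i
  fin_cases i <;> rfl

/-- For lifted strategies the history is a function of the common information, so conditioning on it
adds nothing. -/
theorem prescHist_liftStrategy (g₁ : M.Strategy 0) (g₂ : M.Strategy 1) :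
    ∀ {t} {ω ω' : M.Play t}, M.common t ω = M.common t ω' →
      prescHist (liftStrategy g₁) (liftStrategy g₂) t ω =
        prescHist (liftStrategy g₁) (liftStrategy g₂) t ω'
  | 0, _, _, _ => rfl
  | t + 1, ω, ω', h => by
    have h' : M.common t ω.1 = M.common t ω'.1 := congrArg Prod.fst h
    change (_, _, _) = (_, _, _)
    rw [prescHist_liftStrategy g₁ g₂ h', h']

variable {M} in
/-- The belief obtained from the common information by updating with the prescriptions of a
strategy of Team 1. -/
def beliefAlong (F : M.Update) (g₁ : M.Strategy 0) : ∀ t, M.Common t → M.Belief t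
  | 0, z => M.initBelief z
  | t + 1, cz => F t (beliefAlong F g₁ t cz.1) (fun j p => g₁ t j cz.1 p) cz.2

theorem cib_zero (χ₁ : M.VStrategy 0) (χ₂ : M.VStrategy 1) (ω : M.Play 0) :
    M.cib χ₁ χ₂ 0 ω = M.initBelief (M.common 0 ω) := by
  classical
  unfold cib initBelief
  congr 1
  funext xp
  change ∑ ω' : M.X 0 × M.Obs 0, _ = _
  rw [Fintype.sum_prod_type, Finset.sum_eq_single xp.1]
  · refine Finset.sum_congr rfl fun y _ => if_congr ?_ rfl rfl
    exact ⟨fun h => ⟨h.2.1, h.2.2.1⟩, fun h => ⟨rfl, h.1, h.2, rfl⟩⟩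
  · rintro x - hne
    exact Finset.sum_eq_zero fun y _ => if_neg fun h => hne h.1
  · simp

theorem cib_eq_beliefAlong {F : M.Update} (hF : M.IsCIBUpdate F) (g₁ : M.Strategy 0)
    (g₂ : M.Strategy 1) : ∀ {t}, t < M.T → ∀ {ω : M.Play t},
      0 < M.playProb (M.vdraw (liftStrategy g₁) (liftStrategy g₂)) t ω →
        M.cib (liftStrategy g₁) (liftStrategy g₂) t ω = beliefAlong F g₁ t (M.common t ω)
  | 0, _, ω, _ => M.cib_zero _ _ ω
  | t + 1, ht, ω, hω => by
    rw [hF _ _ t ht ω hω, cib_eq_beliefAlong hF g₁ g₂ ((Nat.lt_succ_self t).trans ht)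
      (M.playProb_pos_of_succ hω)]
    rfl

/-- The tower property, conditioning on the common information. -/
theorem sum_playProb_mul_eq_sum_beliefAlong {F : M.Update} (hF : M.IsCIBUpdate F)
    (g₁ : M.Strategy 0) (g₂ : M.Strategy 1) {t : ℕ} (ht : t < M.T)
    (ψ : M.Common t → M.X t × M.Priv t → ℝ) :
    ∑ ω, M.playProb (M.vdraw (liftStrategy g₁) (liftStrategy g₂)) t ω *
        ψ (M.common t ω) (M.state t ω, M.priv t ω) =
      ∑ ω, M.playProb (M.vdraw (liftStrategy g₁) (liftStrategy g₂)) t ω *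
        ∑ xp, beliefAlong F g₁ t (M.common t ω) xp * ψ (M.common t ω) xp := by
  classical
  have hmap : ∀ ω ∈ (Finset.univ : Finset (M.Play t)),
      M.common t ω ∈ Finset.univ.image (M.common t) := fun ω _ =>
    Finset.mem_image_of_mem _ (Finset.mem_univ ω)
  rw [← Finset.sum_fiberwise_of_maps_to hmap, ← Finset.sum_fiberwise_of_maps_to hmap]
  refine Finset.sum_congr rfl fun c _ => ?_
  by_cases hc : ∃ ω, M.common t ω = c ∧
      0 < M.playProb (M.vdraw (liftStrategy g₁) (liftStrategy g₂)) t ω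
  · obtain ⟨ω, rfl, hω⟩ := hc
    have hiff : ∀ ω', M.common t ω' = M.common t ω ↔ (M.common t ω' = M.common t ω ∧
        prescHist (liftStrategy g₁) (liftStrategy g₂) t ω' =
          prescHist (liftStrategy g₁) (liftStrategy g₂) t ω) := fun ω' =>
      ⟨fun h => ⟨h, M.prescHist_liftStrategy g₁ g₂ h⟩, And.left⟩
    have h := M.sum_class_eq_classProb_mul hω (ψ (M.common t ω))
    rw [M.cib_eq_beliefAlong hF g₁ g₂ ht hω] at h
    unfold classProb at h
    simp_rw [← hiff] at h
    rw [Finset.sum_mul] at h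
    rw [Finset.sum_filter, Finset.sum_filter]
    refine (Finset.sum_congr rfl fun ω' _ => ?_).trans
      (h.trans (Finset.sum_congr rfl fun ω' _ => ?_))
    · split_ifs with h'
      · rw [h']
      · rw [mul_zero]
    · split_ifs with h'
      · rw [h']
      · rw [zero_mul]
  -- On null values of the common information the tracked belief need not be the conditional law,
  -- but both sides vanish.
  · have h0 : ∀ ω, M.common t ω = c →
        M.playProb (M.vdraw (liftStrategy g₁) (liftStrategy g₂)) t ω = 0 := fun ω h =>
      ((M.playProb_nonneg _ t ω).eq_or_lt.resolve_right fun h' => hc ⟨ω, h, h'⟩).symm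
    refine Finset.sum_congr rfl fun ω hω => ?_
    rw [h0 ω (Finset.mem_filter.1 hω).2, zero_mul, zero_mul]

/-! ### Verification -/

/-- Expected cost incurred before time `t` plus the upper value at time `t` of the belief
computed from the common information. -/
def potential (F : M.Update) (g₁ : M.Strategy 0) (g₂ : M.Strategy 1) (t : ℕ) : ℝ :=
  ∑ ω, M.playProb (M.vdraw (liftStrategy g₁) (liftStrategy g₂)) t ω *
    (M.totalCost t ω + M.V F t (beliefAlong F g₁ t (M.common t ω)))

/-- The belief has to be the true conditional law at time `t < M.T` only. At time `t + 1` merely its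
recursion is used, so the last step is covered although `F` is unconstrained there. -/
theorem potential_succ {F : M.Update} (hF : M.IsCIBUpdate F) (g₁ : M.Strategy 0)
    (g₂ : M.Strategy 1) {t : ℕ} (ht : t < M.T) :
    M.potential F g₁ g₂ (t + 1) =
      ∑ ω, M.playProb (M.vdraw (liftStrategy g₁) (liftStrategy g₂)) t ω *
        (M.totalCost t ω + M.w F t (beliefAlong F g₁ t (M.common t ω))
          (fun j p => g₁ t j (M.common t ω) p) (fun j p => g₂ t j (M.common t ω) p)) := by
  classical
  -- The conditional expectation of the stage cost plus the continuation value, given state, private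
  -- and common information; averaging it over the belief gives `w`.
  let ψ : M.Common t → M.X t × M.Priv t → ℝ := fun c xp =>
    ∑ a, actProb (t := t) (fun j p => g₁ t j c p) (fun j p => g₂ t j c p) xp.2 a *
      (M.c t xp.1 a + ∑ x', ∑ y', M.stepProb t xp.1 a x' y' *
        M.V F (t + 1) (F t (beliefAlong F g₁ t c) (fun j p => g₁ t j c p) (M.ζ t xp.2 a y')))
  have hψ : ∀ c, ∑ xp, beliefAlong F g₁ t c xp * ψ c xp =
      M.w F t (beliefAlong F g₁ t c) (fun j p => g₁ t j c p) (fun j p => g₂ t j c p) := by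
    intro c
    unfold w costToGo stageCost incrProb
    simp_rw [Finset.sum_mul (s := (Finset.univ : Finset (M.X t)))]
    rw [Finset.sum_comm (s := (Finset.univ : Finset (M.Z (t + 1)))), Fintype.sum_prod_type,
      ← Finset.sum_add_distrib]
    refine Finset.sum_congr rfl fun x _ => ?_
    simp_rw [Finset.sum_mul (s := (Finset.univ : Finset (M.Priv t)))]
    rw [Finset.sum_comm (s := (Finset.univ : Finset (M.Z (t + 1)))), ← Finset.sum_add_distrib]
    refine Finset.sum_congr rfl fun p _ => ?_
    simp_rw [Finset.sum_mul (s := (Finset.univ : Finset (M.Act t)))]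
    rw [Finset.sum_comm (s := (Finset.univ : Finset (M.Z (t + 1)))), ← Finset.sum_add_distrib]
    change _ * (∑ a, _) = _
    rw [Finset.mul_sum]
    refine Finset.sum_congr rfl fun a _ => ?_
    simp_rw [mul_assoc, ← Finset.mul_sum]
    rw [mul_add, mul_add, mul_left_comm, mul_left_comm (M.c t x a), mul_comm (M.c t x a),
      mul_left_comm]
    congr 3
    simp_rw [Finset.sum_mul (s := (Finset.univ : Finset (M.X (t + 1))))]
    rw [Finset.sum_comm (s := (Finset.univ : Finset (M.Z (t + 1))))]
    refine Finset.sum_congr rfl fun x' _ => ?_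
    simp_rw [Finset.sum_mul (s := (Finset.univ : Finset (M.Obs (t + 1))))]
    rw [Finset.sum_comm (s := (Finset.univ : Finset (M.Z (t + 1))))]
    refine Finset.sum_congr rfl fun y' _ => ?_
    simp [ite_mul]
  unfold potential
  rw [sum_playProb_succ]
  simp_rw [mul_add (M.playProb _ t _), Finset.sum_add_distrib, ← hψ]
  rw [← M.sum_playProb_mul_eq_sum_beliefAlong hF g₁ g₂ ht, ← Finset.sum_add_distrib]
  refine Finset.sum_congr rfl fun ω _ => ?_
  rw [← mul_add]
  congr 1
  have hsplit : ∀ a, ∑ x', ∑ y', M.stepProb t (M.state t ω) a x' y' *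
      (M.totalCost (t + 1) (ω, a, x', y') +
        M.V F (t + 1) (beliefAlong F g₁ (t + 1) (M.common (t + 1) (ω, a, x', y')))) =
      M.totalCost t ω + (M.c t (M.state t ω) a +
        ∑ x', ∑ y', M.stepProb t (M.state t ω) a x' y' *
          M.V F (t + 1) (F t (beliefAlong F g₁ t (M.common t ω))
            (fun j p => g₁ t j (M.common t ω) p) (M.ζ t (M.priv t ω) a y'))) := by
    intro a
    simp_rw [mul_add, Finset.sum_add_distrib]
    rw [← add_assoc]
    refine congrArg₂ (· + ·) ?_ rfl
    change ∑ x', ∑ y', M.stepProb t (M.state t ω) a x' y' *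
      (M.totalCost t ω + M.c t (M.state t ω) a) = _
    simp_rw [← Finset.sum_mul]
    rw [sum_stepProb, one_mul]
  simp_rw [hsplit]
  simp_rw [mul_add (actProb _ _ _ _) (M.totalCost t ω), Finset.sum_add_distrib, ← Finset.sum_mul]
  rw [sum_actProb, one_mul]
  rfl

theorem potential_horizon (F : M.Update) (g₁ : M.Strategy 0) (g₂ : M.Strategy 1) :
    M.potential F g₁ g₂ M.T = M.J g₁ g₂ := by
  unfold potential J
  simp_rw [V_horizon, add_zero, vdraw_liftStrategy]

/-- Expected upper value of the initial belief. -/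
def expectedInitialValue (F : M.Update) : ℝ :=
  ∑ ω : M.Play 0, M.initProb ω.1 ω.2 * M.V F 0 (M.initBelief (M.common 0 ω))

theorem potential_zero (F : M.Update) (g₁ : M.Strategy 0) (g₂ : M.Strategy 1) :
    M.potential F g₁ g₂ 0 = M.expectedInitialValue F :=
  Finset.sum_congr rfl fun ω _ => by
    change M.initProb ω.1 ω.2 * (0 + M.V F 0 (M.initBelief (M.common 0 ω))) = _
    rw [zero_add]

theorem J_le_expectedInitialValue {F : M.Update} (hF : M.IsCIBUpdate F) {g₁ : M.Strategy 0}
    {g₂ : M.Strategy 1} (h : ∀ t < M.T, ∀ c : M.Common t,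
      M.w F t (beliefAlong F g₁ t c) (fun j p => g₁ t j c p) (fun j p => g₂ t j c p) ≤
        M.V F t (beliefAlong F g₁ t c)) :
    M.J g₁ g₂ ≤ M.expectedInitialValue F := by
  rw [← M.potential_horizon F, ← M.potential_zero F g₁ g₂]
  have key : ∀ t ≤ M.T, M.potential F g₁ g₂ t ≤ M.potential F g₁ g₂ 0 := by
    intro t
    induction t with
    | zero => exact fun _ => le_rfl
    | succ t ih =>
      refine fun ht => le_trans ?_ (ih (Nat.le_of_succ_le ht))
      rw [M.potential_succ hF g₁ g₂ ht]
      exact Finset.sum_le_sum fun ω _ => mul_le_mul_of_nonneg_left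
        (add_le_add_right (h t ht _) _) (M.playProb_nonneg _ _ _)
  exact key _ le_rfl

theorem expectedInitialValue_le_J {F : M.Update} (hF : M.IsCIBUpdate F) {g₁ : M.Strategy 0}
    {g₂ : M.Strategy 1} (h : ∀ t < M.T, ∀ c : M.Common t, M.V F t (beliefAlong F g₁ t c) ≤
      M.w F t (beliefAlong F g₁ t c) (fun j p => g₁ t j c p) (fun j p => g₂ t j c p)) :
    M.expectedInitialValue F ≤ M.J g₁ g₂ := by
  rw [← M.potential_horizon F, ← M.potential_zero F g₁ g₂]
  have key : ∀ t ≤ M.T, M.potential F g₁ g₂ 0 ≤ M.potential F g₁ g₂ t := by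
    intro t
    induction t with
    | zero => exact fun _ => le_rfl
    | succ t ih =>
      refine fun ht => (ih (Nat.le_of_succ_le ht)).trans ?_
      rw [M.potential_succ hF g₁ g₂ ht]
      exact Finset.sum_le_sum fun ω _ => mul_le_mul_of_nonneg_left
        (add_le_add_right (h t ht _) _) (M.playProb_nonneg _ _ _)
  exact key _ le_rfl

/-- Since `g₁` is fixed, the tracked belief is a function of the common information. Team 2's
maximizing prescriptions are then too, and so they form a strategy of the original game. -/
theorem exists_expectedInitialValue_le_J {F : M.Update} (hF : M.IsCIBUpdate F)
    (g₁ : M.Strategy 0) : ∃ g₂, M.expectedInitialValue F ≤ M.J g₁ g₂ := by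
  have key : ∀ t (c : M.Common t), ∃ γ₂ : M.Presc t 1, t < M.T →
      M.V F t (beliefAlong F g₁ t c) ≤
        M.w F t (beliefAlong F g₁ t c) (fun j p => g₁ t j c p) γ₂ := by
    intro t c
    by_cases ht : t < M.T
    · obtain ⟨γ₂, h⟩ := M.exists_V_le_w F ht (beliefAlong F g₁ t c) fun j p => g₁ t j c p
      exact ⟨γ₂, fun _ => h⟩
    · exact ⟨Classical.arbitrary _, fun h => absurd h ht⟩
  choose γ₂ hγ₂ using key
  exact ⟨fun t j c p => γ₂ t c j p, M.expectedInitialValue_le_J hF fun t ht c => hγ₂ t c ht⟩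

theorem beliefAlong_algorithmStrategy (F : M.Update) (Ξ : ∀ t, M.Belief t → M.Presc t 0) :
    ∀ t (c : M.Common t), beliefAlong F (algorithmStrategy F Ξ) t c = trackedBelief F Ξ t c
  | 0, _ => rfl
  | t + 1, c => by
    change F t (beliefAlong F _ t c.1) _ _ = F t (trackedBelief F Ξ t c.1) _ _
    rw [beliefAlong_algorithmStrategy]
    rfl

/-- `expectedInitialValue` bounds the algorithm's cost from above against all opponents and the
worst-case cost of every strategy from below, so it is the upper value. Applied to the algorithm
itself, the lower bound supplies an opponent that attains it. -/
theorem isMinMax_algorithmStrategy {F : M.Update} (hF : M.IsCIBUpdate F)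
    {Ξ : ∀ t, M.Belief t → M.Presc t 0} (hΞ : M.IsDPMinimizer F Ξ) :
    M.IsMinMax (algorithmStrategy F Ξ) := by
  have hle : ∀ g₂, M.J (algorithmStrategy F Ξ) g₂ ≤ M.expectedInitialValue F := fun g₂ =>
    M.J_le_expectedInitialValue hF fun t ht c => by
      rw [beliefAlong_algorithmStrategy]
      exact (hΞ t ht (trackedBelief F Ξ t c)).2 ⟨_, rfl⟩
  obtain ⟨g₂, hg₂⟩ := M.exists_expectedInitialValue_le_J hF (algorithmStrategy F Ξ)
  have hgr : IsGreatest (Set.range fun g₂ => M.J (algorithmStrategy F Ξ) g₂)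
      (M.expectedInitialValue F) :=
    ⟨⟨g₂, (hle g₂).antisymm hg₂⟩, by rintro _ ⟨g, rfl⟩; exact hle g⟩
  have hsup : ∀ g₁, M.expectedInitialValue F ≤ ⨆ g₂, M.J g₁ g₂ := fun g₁ => by
    obtain ⟨g, hg⟩ := M.exists_expectedInitialValue_le_J hF g₁
    exact le_ciSup_of_le (M.bddAbove_range_J g₁) g hg
  have hval : M.upperValue = M.expectedInitialValue F := by
    refine le_antisymm ?_ (le_ciInf hsup)
    exact (ciInf_le ⟨_, by rintro _ ⟨g₁, rfl⟩; exact hsup g₁⟩ (algorithmStrategy F Ξ)).trans_eq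
      hgr.csSup_eq
  unfold IsMinMax
  rwa [hval]

end TeamGame

end

theorem theorem5 (M : TeamGame.{u}) (hM : ∃ F : M.Update, M.IsCIBUpdate F) :
    (∃ (F : M.Update) (Ξ : ∀ t, M.Belief t → M.Presc t 0),
      M.IsCIBUpdate F ∧ M.IsDPMinimizer F Ξ) ∧
    ∀ (F : M.Update) (Ξ : ∀ t, M.Belief t → M.Presc t 0),
      M.IsCIBUpdate F → M.IsDPMinimizer F Ξ →
        M.IsMinMax (TeamGame.algorithmStrategy F Ξ) := by
  obtain ⟨Ξ, hΞ⟩ := M.exists_isDPMinimizer_bayesUpdate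
  exact ⟨⟨M.bayesUpdate, Ξ, M.isCIBUpdate_bayesUpdate hM, hΞ⟩,
    fun _ _ hF hΞ => M.isMinMax_algorithmStrategy hF hΞ⟩
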